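/- **Setting.** Let $n,k\ge 0$, let $\mathbb C^{n+1+k}$ have coordinates $(z,y)=(z_1,\dots,z_{n+1},y_1,\dots,y_k)$, let $U$ be an open neighbourhood of the origin and $F:U\to\mathbb C$ a complex analytic function. Put $X=\{p\in U: F(p)=0\}$, $Y=U\cap(0\times\mathbb C^k)$, $f_y(z)=F(z,y)$ and $X_y=f_y^{-1}(0)$. Assume that the singular set $S(X)=\{p\in X: dF(p)=0\}$ equals $Y$, and that the only possible singular point of $X_y$ is the origin: if $(z,y)\in X$ and $\partial F/\partial z_i(z,y)=0$ for all $i$, then $z=0$. Let $m_Y=(z_1,\dots,z_{n+1})$ be the ideal sheaf on $X$ defining $Y$, let $J_z(F)$ be the ideal sheaf on $X$ generated by the $\partial F/\partial z_i$, and $J(F)_Y$ the one generated by the $\partial F/\partial y_j$. Let $X\times_Y X=\{((z,y),(z',y'))\in X\times X: y=y'\}$, with projections $p_1,p_2$ to $X$. Inside it let $\Delta(X\times_YX)$ be the diagonal, and let $0\times_Y X$, $X\times_Y 0$, $Y\times(0,0)$ be the sets of pairs whose first component, second component, respectively both components, lie in $Y$. For an ideal sheaf $I$ on $X$ and a point $q=(x,x')$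 of $X\times_Y X$, let $I_D$ at $q$ be the submodule of $\mathcal O^2_{X\times_Y X,q}$ generated by the elements $h_D=(h\circ p_1,h\circ p_2)$, where $h$ is a section of $I$ on a neighbourhood of $\{x,x'\}$ in $X$. The integral closure $\overline M$ of a submodule $M\subset\mathcal O^p_{Z,x}$ consists of all $h\in\mathcal O^p_{Z,x}$ with $h\circ\phi\in(\phi^*M)\mathcal O_1$ for every analytic curve germ $\phi:(\mathbb C,0)\to(Z,x)$, where $\mathcal O_1$ is the ring of germs of analytic functions at $0\in\mathbb C$. Say that - $iL_A$ holds at $q$ if $(J(F)_Y)_D\subset\overline{(J_z(F))_D}$ at $q$; - $iL_{m_Y}$ holds at $q$ if $(J(F)_Y)_D\subset\overline{(m_YJ_z(F))_D}$ at $q$. The pair $(X-Y,Y)$ satisfies (Verdier's) condition W at $y_0\in Y$ if there are a constant $C$ and a neighbourhood $N$ of $y_0$ such that $\operatorname{dist}(T_{y'}Y,T_xX)\le C\|x-y'\|$ for all $x\in(X-Y)\cap N$ and $y'\in Y\cap N$. Here $\operatorname{dist}(A,B)=\sup |(u,v)|/(\|u\|\,\|v\|)$ over nonzero $u\in B^\perp$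 and $v\in A$, and the supremum is $0$ if there are no such $u,v$. **Proposition 4.2.** Both $iL_A$ and $iL_{m_Y}$ hold at every point of $\Delta(X\times_Y X)-Y\times(0,0)$. Both conditions also hold at every point of $\big((0\times_Y X)\cup(X\times_Y 0)\big)-Y\times(0,0)$ for which $(X-Y,Y)$ satisfies W at $(y,0)$, the point of $Y$ with the same parameter $y$. -/

import Mathlib

open Filter Topology

noncomputable section

namespace LipschitzFamily

section LocalRings

variable {V : Type*} [NormedAddCommGroup V] [NormedSpace ℂ V]

/-- The local ring `𝒪_{Z,x}` of the (reduced) analytic set `Z ⊆ V` at `x`: germs at `x` of functions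
on `Z` which are restrictions of functions analytic at `x` on the ambient space. -/
def localRing (Z : Set V) (x : V) : Subring (Germ (𝓝[Z] x) ℂ) where
  carrier := {g | ∃ f : V → ℂ, AnalyticAt ℂ f x ∧ (f : Germ (𝓝[Z] x) ℂ) = g}
  mul_mem' := by
    rintro _ _ ⟨f, hf, rfl⟩ ⟨g, hg, rfl⟩
    exact ⟨f * g, hf.mul hg, rfl⟩
  one_mem' := ⟨fun _ => 1, analyticAt_const, rfl⟩
  add_mem' := by
    rintro _ _ ⟨f, hf, rfl⟩ ⟨g, hg, rfl⟩
    exact ⟨f + g, hf.add hg, rfl⟩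
  zero_mem' := ⟨fun _ => 0, analyticAt_const, rfl⟩
  neg_mem' := by
    rintro _ ⟨f, hf, rfl⟩
    exact ⟨-f, hf.neg, rfl⟩

/-- The element of `𝒪_{Z,x}` given by a function analytic at `x`. -/
def toGerm (Z : Set V) {x : V} (f : V → ℂ) (hf : AnalyticAt ℂ f x) : localRing Z x :=
  ⟨(f : Germ (𝓝[Z] x) ℂ), f, hf, rfl⟩

/-- The ring `𝒪₁` of germs at `0` of analytic functions of one complex variable. -/
abbrev curveRing : Subring (Germ (𝓝[(Set.univ : Set ℂ)] (0 : ℂ)) ℂ) :=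
  localRing (Set.univ : Set ℂ) 0

/-- An analytic curve germ `φ : (ℂ, 0) → (Z, x)`. -/
structure CurveGerm (Z : Set V) (x : V) where
  toFun : ℂ → V
  analyticAt : AnalyticAt ℂ toFun 0
  map_zero : toFun 0 = x
  eventually_mem : ∀ᶠ t in 𝓝 (0 : ℂ), toFun t ∈ Z

theorem CurveGerm.tendsto {Z : Set V} {x : V} (φ : CurveGerm Z x) :
    Tendsto φ.toFun (𝓝[(Set.univ : Set ℂ)] (0 : ℂ)) (𝓝[Z] x) := by
  rw [nhdsWithin_univ]
  refine tendsto_nhdsWithin_iff.2 ⟨?_, φ.eventually_mem⟩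
  have h := φ.analyticAt.continuousAt.tendsto
  rwa [φ.map_zero] at h

/-- Composition with `φ`, as a ring homomorphism `φ^* : 𝒪_{Z,x} → 𝒪₁`. -/
def CurveGerm.pullback {Z : Set V} {x : V} (φ : CurveGerm Z x) :
    localRing Z x →+* curveRing where
  toFun g := ⟨(g : Germ (𝓝[Z] x) ℂ).compTendsto φ.toFun φ.tendsto, by
    obtain ⟨_, f, hf, rfl⟩ := g
    refine ⟨f ∘ φ.toFun, ?_, rfl⟩
    apply AnalyticAt.comp _ φ.analyticAt
    rwa [φ.map_zero]⟩
  map_one' := rfl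
  map_zero' := rfl
  map_mul' := by
    rintro ⟨_, f, hf, rfl⟩ ⟨_, g, hg, rfl⟩
    rfl
  map_add' := by
    rintro ⟨_, f, hf, rfl⟩ ⟨_, g, hg, rfl⟩
    rfl

/-- Componentwise composition `𝒪_{Z,x}^p → 𝒪₁^p`, `h ↦ h ∘ φ`. -/
def CurveGerm.pullbackVec {Z : Set V} {x : V} (φ : CurveGerm Z x) {p : ℕ}
    (h : Fin p → localRing Z x) : Fin p → curveRing :=
  fun i => φ.pullback (h i)

/-- The `𝒪₁`-submodule `(φ^* M) 𝒪₁` of `𝒪₁^p`. -/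
def CurveGerm.pullbackModule {Z : Set V} {x : V} (φ : CurveGerm Z x) {p : ℕ}
    (M : Submodule (localRing Z x) (Fin p → localRing Z x)) :
    Submodule curveRing (Fin p → curveRing) :=
  Submodule.span curveRing (φ.pullbackVec '' (M : Set (Fin p → localRing Z x)))

/-- The integral closure of a submodule `M ⊆ 𝒪_{Z,x}^p`: all `h` with `h ∘ φ ∈ (φ^* M) 𝒪₁` for
every analytic curve germ `φ : (ℂ, 0) → (Z, x)`. -/
def integralClosure {Z : Set V} {x : V} {p : ℕ}
    (M : Submodule (localRing Z x) (Fin p → localRing Z x)) :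
    Submodule (localRing Z x) (Fin p → localRing Z x) where
  carrier := {h | ∀ φ : CurveGerm Z x, φ.pullbackVec h ∈ φ.pullbackModule M}
  add_mem' := by
    intro a b ha hb φ
    have e : φ.pullbackVec (a + b) = φ.pullbackVec a + φ.pullbackVec b := by
      funext i
      exact map_add φ.pullback (a i) (b i)
    rw [e]
    exact Submodule.add_mem _ (ha φ) (hb φ)
  zero_mem' := by
    intro φ
    have e : φ.pullbackVec (0 : Fin p → localRing Z x) = 0 := by
      funext i
      exact map_zero φ.pullback
    rw [e]
    exact Submodule.zero_mem _
  smul_mem' := by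
    intro c a ha φ
    have e : φ.pullbackVec (c • a) = φ.pullback c • φ.pullbackVec a := by
      funext i
      exact map_mul φ.pullback c (a i)
    rw [e]
    exact Submodule.smul_mem _ _ (ha φ)

end LocalRings

/-- The ambient space `ℂ^{n+1+k}`, with coordinates `z_i = p (Sum.inl i)` and
`y_j = p (Sum.inr j)` and its standard Hermitian structure. -/
abbrev Ambient (n k : ℕ) : Type := EuclideanSpace ℂ (Fin (n + 1) ⊕ Fin k)

/-- The partial derivative of `F` with respect to the coordinate with index `c`. -/
def partialDeriv {n k : ℕ} (F : Ambient n k → ℂ) (c : Fin (n + 1) ⊕ Fin k) (p : Ambient n k) : ℂ :=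
  fderiv ℂ F p (EuclideanSpace.single c 1)

/-- A family `X = {F = 0}` of hypersurfaces with isolated singularities, given on an open
neighbourhood `U` of the origin: the singular set of `X` is `Y = 0 × ℂ^k` (within `U`), and the only
possible singular point of the fibre `X_y = f_y⁻¹(0)`, `f_y(z) = F(z, y)`, is the origin. -/
structure HypersurfaceFamily (n k : ℕ) where
  U : Set (Ambient n k)
  F : Ambient n k → ℂ
  isOpen_U : IsOpen U
  zero_mem_U : (0 : Ambient n k) ∈ U
  analyticOnNhd_F : AnalyticOnNhd ℂ F U
  /-- `S(X) = Y`. -/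
  singularSet_eq : {p | p ∈ U ∧ F p = 0 ∧ fderiv ℂ F p = 0} =
    {p | p ∈ U ∧ ∀ i : Fin (n + 1), p (Sum.inl i) = 0}
  /-- If `f_y` is singular at a point `z` of `X_y`, then `z = 0`. -/
  fibre_singular : ∀ p ∈ U, F p = 0 → (∀ i : Fin (n + 1), partialDeriv F (Sum.inl i) p = 0) →
    ∀ i : Fin (n + 1), p (Sum.inl i) = 0

namespace HypersurfaceFamily

variable {n k : ℕ} (S : HypersurfaceFamily n k)

/-- The total space `X`. -/
def X : Set (Ambient n k) := {p | p ∈ S.U ∧ S.F p = 0}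

/-- The parameter space `Y = 0 × ℂ^k` (within `U`). -/
def Y : Set (Ambient n k) := {p | p ∈ S.U ∧ ∀ i : Fin (n + 1), p (Sum.inl i) = 0}

/-- The fibre product `X ×_Y X`, inside `ℂ^{n+1+k} × ℂ^{n+1+k}`. -/
def fibreProduct : Set (Ambient n k × Ambient n k) :=
  {q | q.1 ∈ S.X ∧ q.2 ∈ S.X ∧ ∀ j : Fin k, q.1 (Sum.inr j) = q.2 (Sum.inr j)}

/-- The diagonal `Δ(X ×_Y X)`. -/
def diagonal : Set (Ambient n k × Ambient n k) := {q | q ∈ S.fibreProduct ∧ q.1 = q.2}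

/-- The subset `0 ×_Y X` of `X ×_Y X`. -/
def zeroFibreX : Set (Ambient n k × Ambient n k) := {q | q ∈ S.fibreProduct ∧ q.1 ∈ S.Y}

/-- The subset `X ×_Y 0` of `X ×_Y X`. -/
def xFibreZero : Set (Ambient n k × Ambient n k) := {q | q ∈ S.fibreProduct ∧ q.2 ∈ S.Y}

/-- The subset `Y × (0, 0)` of `X ×_Y X`. -/
def yTimesZero : Set (Ambient n k × Ambient n k) :=
  {q | q ∈ S.fibreProduct ∧ q.1 ∈ S.Y ∧ q.2 ∈ S.Y}

/-- Ideal sheaves on `X`, through their stalks. -/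
abbrev StalkIdeals : Type := ∀ p : Ambient n k, Ideal (localRing S.X p)

/-- `J_z(F)`, generated by the partial derivatives with respect to the `z` coordinates. -/
def Jz : S.StalkIdeals := fun p =>
  Ideal.span {g | ∃ i : Fin (n + 1),
    (g : Germ (𝓝[S.X] p) ℂ) = (partialDeriv S.F (Sum.inl i) : Ambient n k → ℂ)}

/-- `J(F)_Y`, generated by the partial derivatives with respect to the `y` coordinates. -/
def JY : S.StalkIdeals := fun p =>
  Ideal.span {g | ∃ j : Fin k,
    (g : Germ (𝓝[S.X] p) ℂ) = (partialDeriv S.F (Sum.inr j) : Ambient n k → ℂ)}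

/-- `m_Y`, the ideal defining `Y`, generated by the `z` coordinates. -/
def mY : S.StalkIdeals := fun p =>
  Ideal.span {g | ∃ i : Fin (n + 1),
    (g : Germ (𝓝[S.X] p) ℂ) = ((fun x => x (Sum.inl i)) : Ambient n k → ℂ)}

/-- `m_Y J_z(F)`. -/
def mYJz : S.StalkIdeals := fun p => S.mY p * S.Jz p

/-- The stalk at `q = (x, x')` of the double `I_D` of an ideal sheaf `I` on `X`: the submodule of
`𝒪²_{X ×_Y X, q}` generated by the elements `h_D = (h ∘ p₁, h ∘ p₂)`, for `h` a section of `I` on a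
neighbourhood of `{x, x'}` in `X`. If `x = x'`, then `h` runs over the stalk of `I` at `x`. -/
def double (I : S.StalkIdeals) (q : Ambient n k × Ambient n k) :
    Submodule (localRing S.fibreProduct q) (Fin 2 → localRing S.fibreProduct q) :=
  Submodule.span _ {m | ∃ (h : Ambient n k → ℂ) (h₁ : AnalyticAt ℂ h q.1) (h₂ : AnalyticAt ℂ h q.2),
    toGerm S.X h h₁ ∈ I q.1 ∧ toGerm S.X h h₂ ∈ I q.2 ∧
    (m 0 : Germ (𝓝[S.fibreProduct] q) ℂ) = (fun r => h r.1 : Ambient n k × Ambient n k → ℂ) ∧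
    (m 1 : Germ (𝓝[S.fibreProduct] q) ℂ) = (fun r => h r.2 : Ambient n k × Ambient n k → ℂ)}

/-- Condition `iL_A` at a point `q` of `X ×_Y X`. -/
def iLA (q : Ambient n k × Ambient n k) : Prop :=
  S.double S.JY q ≤ integralClosure (S.double S.Jz q)

/-- Condition `iL_{m_Y}` at a point `q` of `X ×_Y X`. -/
def iLmY (q : Ambient n k × Ambient n k) : Prop :=
  S.double S.JY q ≤ integralClosure (S.double S.mYJz q)

/-- The distance `sup |(u, v)| / (‖u‖ ‖v‖)`, over nonzero `u ∈ B^⊥` and `v ∈ A`, of two linear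
subspaces. The set of quotients is bounded by `1`; if it is empty, the distance is `0`. -/
def subspaceDist (A B : Submodule ℂ (Ambient n k)) : ℝ :=
  sSup {r | ∃ u ∈ Bᗮ, ∃ v ∈ A, u ≠ 0 ∧ v ≠ 0 ∧ r = ‖inner ℂ u v‖ / (‖u‖ * ‖v‖)}

/-- The tangent space of `X` at a smooth point `p`. -/
def tangentX (p : Ambient n k) : Submodule ℂ (Ambient n k) :=
  LinearMap.ker (fderiv ℂ S.F p).toLinearMap

/-- The tangent space of `Y = 0 × ℂ^k` (at any of its points). -/
def tangentY (n k : ℕ) : Submodule ℂ (Ambient n k) where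
  carrier := {v | ∀ i : Fin (n + 1), v (Sum.inl i) = 0}
  add_mem' := by
    intro a b ha hb i
    simp [ha i, hb i]
  zero_mem' := by
    intro i
    simp
  smul_mem' := by
    intro c a ha i
    simp [ha i]

/-- Verdier's condition W for the pair `(X - Y, Y)` at the point `y₀` of `Y`: near `y₀`, the
distance from `T_y Y` to `T_x X` is bounded by a constant multiple of `‖x - y‖`. -/
def ConditionW (y₀ : Ambient n k) : Prop :=
  ∃ C : ℝ, ∃ N ∈ 𝓝 y₀, ∀ x ∈ (S.X \ S.Y) ∩ N, ∀ y ∈ S.Y ∩ N,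
    subspaceDist (tangentY n k) (S.tangentX x) ≤ C * ‖x - y‖

end HypersurfaceFamily

end LipschitzFamily

end

/-! Off $Y$, some coordinate $z_l$ and some $\partial F/\partial z_i$ are units, so $m_YJ_z(F)$ is
the whole local ring (`mYJz_eq_top`). On the diagonal away from $Y$ the doubles are therefore nested
with no closure needed. A point of the second kind is off the diagonal. There $h$ can be prescribed
independently near its two components, so the double splits and each component can be treated
separately (`double_le_integralClosure`). The component off $Y$ is trivial. At the one in $Y$,
condition W gives $|\partial F/\partial y_j| \le C'\,|z|\,|\partial_z F|$ (`partialDeriv_isBigO`).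
Along a curve this growth bound becomes ideal membership, because ideals of $\mathcal O_1$ are
governed by order (`toGerm_mem_of_isBigO`). Only $iL_{m_Y}$ needs proof: it implies $iL_A$ since
$m_YJ_z(F)\subset J_z(F)$. -/

noncomputable section

namespace LipschitzFamily

/-! ### Orders of vanishing and ideals of $\mathcal O_1$ -/

section Curves

/-- An analytic function germ in one variable is a multiple of every germ of at most its order. -/
theorem exists_eventuallyEq_mul_of_order_le {f g : ℂ → ℂ} (hf : AnalyticAt ℂ f 0)
    (hg : AnalyticAt ℂ g 0) (h : analyticOrderAt f 0 ≤ analyticOrderAt g 0) :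
    ∃ c : ℂ → ℂ, AnalyticAt ℂ c 0 ∧ g =ᶠ[𝓝 0] fun t => c t * f t := by
  by_cases hft : analyticOrderAt f 0 = ⊤
  · rw [hft, top_le_iff, analyticOrderAt_eq_top] at h
    exact ⟨fun _ => 0, analyticAt_const, h.mono fun t ht => by simp [ht]⟩
  obtain ⟨u, hu, hu0, hfu⟩ := hf.analyticOrderAt_ne_top.1 hft
  rw [← Nat.cast_analyticOrderNatAt hft, natCast_le_analyticOrderAt hg] at h
  obtain ⟨v, hv, hgv⟩ := h
  refine ⟨fun t => v t / u t, hv.div hu hu0, ?_⟩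
  filter_upwards [hfu, hgv, hu.continuousAt.eventually_ne hu0] with t h₁ h₂ h₃
  rw [h₁, h₂]
  simp only [smul_eq_mul]
  field_simp

/-- If $g$ had smaller order, $f$ would equal $c\,t\,g$ with $c$ analytic. Then $|g|\le K|ct||g|$
with $K|ct|\to 0$ forces $g=0$, whose order is infinite. -/
theorem order_le_of_isBigO {f g : ℂ → ℂ} (hf : AnalyticAt ℂ f 0) (hg : AnalyticAt ℂ g 0)
    (h : g =O[𝓝 0] f) : analyticOrderAt f 0 ≤ analyticOrderAt g 0 := by
  by_contra! hlt
  have hid : AnalyticAt ℂ (id : ℂ → ℂ) 0 := analyticAt_id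
  have hle : analyticOrderAt ((id : ℂ → ℂ) * g) 0 ≤ analyticOrderAt f 0 := by
    rw [analyticOrderAt_mul hid hg, analyticOrderAt_id, add_comm]
    exact Order.add_one_le_of_lt hlt
  obtain ⟨c, hc, hfc⟩ := exists_eventuallyEq_mul_of_order_le (hid.mul hg) hf hle
  obtain ⟨K, hK⟩ := h.bound
  have hlim : Tendsto (fun t : ℂ => K * ‖c t * t‖) (𝓝 0) (𝓝 0) := by
    have hcont : ContinuousAt (fun t : ℂ => K * ‖c t * t‖) 0 :=
      continuousAt_const.mul (hc.continuousAt.mul continuousAt_id).norm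
    simpa [ContinuousAt] using hcont
  refine hlt.ne_top (analyticOrderAt_eq_top.2 ?_)
  filter_upwards [hK, hfc, hlim.eventually_lt_const zero_lt_one] with t h₁ h₂ h₃
  rw [h₂] at h₁
  have h₄ : ‖g t‖ ≤ (K * ‖c t * t‖) * ‖g t‖ := by
    simpa [mul_assoc] using h₁
  have h₅ : ‖g t‖ ≤ 0 := by nlinarith [norm_nonneg (g t)]
  simpa using h₅

/-- The valuative criterion: a germ bounded by the generators of an ideal of `𝒪₁` lies in it. -/
theorem toGerm_mem_of_isBigO {ι : Type*} [Fintype ι] {a : ι → ℂ → ℂ} {g : ℂ → ℂ}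
    (ha : ∀ i, AnalyticAt ℂ (a i) 0) (hg : AnalyticAt ℂ g 0)
    (h : g =O[𝓝 0] fun t => ∑ i, ‖a i t‖) {I : Ideal curveRing}
    (hI : ∀ i, toGerm Set.univ (a i) (ha i) ∈ I) : toGerm Set.univ g hg ∈ I := by
  rcases isEmpty_or_nonempty ι with hι | hι
  · have h0 : toGerm Set.univ g hg = 0 := by
      apply Subtype.ext
      refine Germ.coe_eq.2 ?_
      rw [nhdsWithin_univ]
      have h' : g =ᶠ[𝓝 0] 0 := by simpa using h
      exact h'
    rw [h0]
    exact I.zero_mem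
  -- A generator of least order divides all the others, so it alone controls the sum.
  obtain ⟨i₀, -, hi₀⟩ := Finset.exists_min_image Finset.univ (fun i => analyticOrderAt (a i) 0)
    Finset.univ_nonempty
  have hO : (fun t => ∑ i, ‖a i t‖) =O[𝓝 0] a i₀ := by
    refine Asymptotics.IsBigO.fun_sum fun i _ => Asymptotics.IsBigO.norm_left ?_
    obtain ⟨c, hc, hic⟩ :=
      exists_eventuallyEq_mul_of_order_le (ha i₀) (ha i) (hi₀ i (Finset.mem_univ i))
    refine hic.trans_isBigO ?_
    simpa using (hc.continuousAt.isBigO_one ℂ).mul (Asymptotics.isBigO_refl (a i₀) (𝓝 0))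
  obtain ⟨c, hc, hgc⟩ := exists_eventuallyEq_mul_of_order_le (ha i₀) hg
    (order_le_of_isBigO (ha i₀) hg (h.trans hO))
  have e : toGerm Set.univ g hg = toGerm Set.univ c hc * toGerm Set.univ (a i₀) (ha i₀) := by
    apply Subtype.ext
    refine Germ.coe_eq.2 ?_
    rw [nhdsWithin_univ]
    exact hgc
  rw [e]
  exact I.mul_mem_left _ (hI i₀)

end Curves

/-! ### Generalities on local rings and integral closures -/

section Algebra

variable {V : Type*} [NormedAddCommGroup V] [NormedSpace ℂ V]

theorem le_integralClosure {Z : Set V} {x : V} {p : ℕ}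
    (M : Submodule (localRing Z x) (Fin p → localRing Z x)) : M ≤ integralClosure M :=
  fun _ hm _ => Submodule.subset_span ⟨_, hm, rfl⟩

theorem integralClosure_mono {Z : Set V} {x : V} {p : ℕ}
    {M N : Submodule (localRing Z x) (Fin p → localRing Z x)} (h : M ≤ N) :
    integralClosure M ≤ integralClosure N :=
  fun _ hm φ => Submodule.span_mono (Set.image_mono h) (hm φ)

theorem toGerm_congr {Z : Set V} {x : V} {f g : V → ℂ} (hf : AnalyticAt ℂ f x)
    (hg : AnalyticAt ℂ g x) (h : f =ᶠ[𝓝 x] g) : toGerm Z f hf = toGerm Z g hg :=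
  Subtype.ext (Germ.coe_eq.2 (h.filter_mono nhdsWithin_le_nhds))

theorem isUnit_toGerm {Z : Set V} {x : V} {f : V → ℂ} (hf : AnalyticAt ℂ f x) (h : f x ≠ 0) :
    IsUnit (toGerm Z f hf) := by
  refine IsUnit.of_mul_eq_one (toGerm Z f⁻¹ (hf.inv h)) ?_
  refine Subtype.ext (Germ.coe_eq.2 ?_)
  filter_upwards [nhdsWithin_le_nhds (hf.continuousAt.eventually_ne h)] with y hy
  simp [hy]

end Algebra

theorem norm_le_sum_norm {ι : Type*} [Fintype ι] (v : EuclideanSpace ℂ ι) :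
    ‖v‖ ≤ ∑ c, ‖v c‖ := by
  classical
  have h : v = ∑ c, EuclideanSpace.single c (v c) := by
    ext d
    simp [Pi.single_apply]
  calc ‖v‖ = ‖∑ c, EuclideanSpace.single c (v c)‖ := by rw [← h]
    _ ≤ ∑ c, ‖EuclideanSpace.single c (v c)‖ := norm_sum_le _ _
    _ = ∑ c, ‖v c‖ := by simp

theorem norm_fderiv_le_sum_partialDeriv {n k : ℕ} (F : Ambient n k → ℂ) (p : Ambient n k) :
    ‖fderiv ℂ F p‖ ≤ ∑ c, ‖partialDeriv F c p‖ := by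
  refine ContinuousLinearMap.opNorm_le_bound _ (by positivity) fun v => ?_
  have h : v = ∑ c, v c • EuclideanSpace.single c (1 : ℂ) := by
    ext d
    rcases d with i | j <;> simp [Pi.single_apply]
  calc ‖fderiv ℂ F p v‖ = ‖∑ c, v c * partialDeriv F c p‖ := by
        conv_lhs => rw [h]
        simp [partialDeriv]
    _ ≤ ∑ c, ‖v c * partialDeriv F c p‖ := norm_sum_le _ _
    _ ≤ ∑ c, ‖partialDeriv F c p‖ * ‖v‖ := by
        refine Finset.sum_le_sum fun c _ => ?_
        rw [norm_mul, mul_comm]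
        exact mul_le_mul_of_nonneg_left (PiLp.norm_apply_le v c) (norm_nonneg _)
    _ = (∑ c, ‖partialDeriv F c p‖) * ‖v‖ := (Finset.sum_mul ..).symm

/-! ### Condition W as an estimate on partial derivatives -/

namespace HypersurfaceFamily

variable {n k : ℕ} (S : HypersurfaceFamily n k)

theorem analyticAt_partialDeriv (c : Fin (n + 1) ⊕ Fin k) {p : Ambient n k} (hp : p ∈ S.U) :
    AnalyticAt ℂ (partialDeriv S.F c) p :=
  ((ContinuousLinearMap.apply ℂ ℂ (EuclideanSpace.single c (1 : ℂ))).analyticAt _).comp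
    (S.analyticOnNhd_F.fderiv p hp)

theorem analyticAt_coord (c : Fin (n + 1) ⊕ Fin k) (p : Ambient n k) :
    AnalyticAt ℂ (fun x : Ambient n k => x c) p :=
  (EuclideanSpace.proj c : Ambient n k →L[ℂ] ℂ).analyticAt p

theorem fderiv_eq_zero_of_mem_Y {p : Ambient n k} (hp : p ∈ S.Y) : fderiv ℂ S.F p = 0 := by
  have h : p ∈ {p | p ∈ S.U ∧ S.F p = 0 ∧ fderiv ℂ S.F p = 0} := by
    rw [S.singularSet_eq]
    exact hp
  exact h.2.2

theorem exists_partialDeriv_ne_zero {p : Ambient n k} (hX : p ∈ S.X) (hY : p ∉ S.Y) :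
    ∃ i : Fin (n + 1), partialDeriv S.F (Sum.inl i) p ≠ 0 := by
  by_contra! h
  exact hY ⟨hX.1, S.fibre_singular p hX.1 hX.2 h⟩

/-- Test the supremum on the vector $u\perp T_xX$ dual to $dF$ and on the unit vector $v=e_j$ of
$T_yY$: the quotient is $|\partial F/\partial y_j|/\|dF\|$. -/
theorem norm_partialDeriv_le_subspaceDist {p : Ambient n k} (hX : p ∈ S.X) (hY : p ∉ S.Y)
    (j : Fin k) :
    ‖partialDeriv S.F (Sum.inr j) p‖ ≤
      subspaceDist (tangentY n k) (S.tangentX p) * ‖fderiv ℂ S.F p‖ := by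
  obtain ⟨i, hi⟩ := S.exists_partialDeriv_ne_zero hX hY
  have hF : fderiv ℂ S.F p ≠ 0 := by
    intro h
    simp [partialDeriv, h] at hi
  set u := (InnerProductSpace.toDual ℂ (Ambient n k)).symm (fderiv ℂ S.F p) with hu
  have hun : ‖u‖ = ‖fderiv ℂ S.F p‖ := LinearIsometryEquiv.norm_map _ _
  have hu0 : u ≠ 0 := by
    rw [← norm_ne_zero_iff, hun]
    exact norm_ne_zero_iff.2 hF
  have huv : ∀ v, inner ℂ u v = fderiv ℂ S.F p v := fun v =>
    InnerProductSpace.toDual_symm_apply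
  have hdist : ‖partialDeriv S.F (Sum.inr j) p‖ / ‖fderiv ℂ S.F p‖ ≤
      subspaceDist (tangentY n k) (S.tangentX p) := by
    -- The bound 1 is Cauchy–Schwarz.
    refine le_csSup ⟨1, ?_⟩ ⟨u, ?_, EuclideanSpace.single (Sum.inr j) 1, ?_, hu0, ?_, ?_⟩
    · rintro r ⟨u, -, v, -, -, -, rfl⟩
      exact div_le_one_of_le₀ (norm_inner_le_norm u v) (by positivity)
    · rw [Submodule.mem_orthogonal']
      intro v hv
      rw [huv]
      exact hv
    · intro i
      simp
    · rw [← norm_ne_zero_iff]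
      simp
    · rw [huv, hun]
      simp [partialDeriv]
  rwa [div_le_iff₀ (norm_pos_iff.2 hF)] at hdist

/-- The projection `(z, y) ↦ (0, y)`. -/
def projY (p : Ambient n k) : Ambient n k :=
  WithLp.toLp 2 (Sum.elim (fun _ => 0) fun j => p (Sum.inr j))

theorem continuous_projY : Continuous (projY : Ambient n k → Ambient n k) := by
  refine (PiLp.continuous_toLp 2 _).comp (continuous_pi fun c => ?_)
  rcases c with i | j
  · exact continuous_const
  · exact (EuclideanSpace.proj (Sum.inr j) : Ambient n k →L[ℂ] ℂ).continuous

theorem projY_eq_self {p : Ambient n k} (hp : p ∈ S.Y) : projY p = p := by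
  ext c
  rcases c with i | j
  · simp [projY, hp.2 i]
  · simp [projY]

theorem norm_sub_projY_le (p : Ambient n k) :
    ‖p - projY p‖ ≤ ∑ i : Fin (n + 1), ‖p (Sum.inl i)‖ := by
  refine (norm_le_sum_norm _).trans ?_
  simp [projY, Fintype.sum_sum_type]

/-- Condition W bounds the partial derivatives along `Y` by the generators of `m_Y J_z(F)`. -/
theorem partialDeriv_isBigO {x : Ambient n k} (hx : x ∈ S.Y) (hW : S.ConditionW x) (j : Fin k) :
    partialDeriv S.F (Sum.inr j) =O[𝓝[S.X] x] fun p => ∑ a : Fin (n + 1) × Fin (n + 1),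
      ‖p (Sum.inl a.1) * partialDeriv S.F (Sum.inl a.2) p‖ := by
  obtain ⟨C, N, hN, hCN⟩ := hW
  have hproj : Tendsto projY (𝓝 x) (𝓝 x) := by
    simpa [S.projY_eq_self hx] using (continuous_projY (n := n) (k := k)).tendsto x
  -- The factor $k$ anticipates summing the bounds over all $y_j$: $B\le k|C|z(A+B)\le (A+B)/2$
  -- yields $B\le A$.
  have hsmall : ∀ᶠ p in 𝓝 x, k * (|C| * ∑ i : Fin (n + 1), ‖p (Sum.inl i)‖) < 1 / 2 := by
    have hc : Continuous fun p : Ambient n k =>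
        k * (|C| * ∑ i : Fin (n + 1), ‖p (Sum.inl i)‖) := by fun_prop
    refine (hc.tendsto x).eventually_lt_const ?_
    simp [hx.2]
  refine Asymptotics.IsBigO.of_bound (2 * |C|) ?_
  filter_upwards [self_mem_nhdsWithin, nhdsWithin_le_nhds hN, nhdsWithin_le_nhds (hproj hN),
    nhdsWithin_le_nhds (hproj (S.isOpen_U.mem_nhds hx.1)), nhdsWithin_le_nhds hsmall]
    with p hpX hpN hqN hqU hp
  by_cases hpY : p ∈ S.Y
  · have h0 : partialDeriv S.F (Sum.inr j) p = 0 := by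
      simp [partialDeriv, S.fderiv_eq_zero_of_mem_Y hpY]
    rw [h0, norm_zero]
    positivity
  set z := ∑ i : Fin (n + 1), ‖p (Sum.inl i)‖ with hz
  set A := ∑ i : Fin (n + 1), ‖partialDeriv S.F (Sum.inl i) p‖ with hA
  set B := ∑ j : Fin k, ‖partialDeriv S.F (Sum.inr j) p‖ with hB
  have hz0 : 0 ≤ z := by positivity
  have hA0 : 0 ≤ A := by positivity
  have hB0 : 0 ≤ B := by positivity
  -- W is applied with $y'=(0,y)$, at distance at most $z=\sum_i|z_i|$ from $p$.
  have hdist : subspaceDist (tangentY n k) (S.tangentX p) ≤ |C| * z := by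
    refine (hCN p ⟨⟨hpX, hpY⟩, hpN⟩ (projY p) ⟨⟨hqU, fun i => by simp [projY]⟩, hqN⟩).trans ?_
    exact mul_le_mul (le_abs_self C) (norm_sub_projY_le p) (norm_nonneg _) (abs_nonneg C)
  have hle : ∀ j : Fin k, ‖partialDeriv S.F (Sum.inr j) p‖ ≤ |C| * z * (A + B) := fun j => by
    refine (S.norm_partialDeriv_le_subspaceDist hpX hpY j).trans
      (mul_le_mul hdist ?_ (norm_nonneg _) (by positivity))
    refine (norm_fderiv_le_sum_partialDeriv S.F p).trans ?_
    rw [Fintype.sum_sum_type]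
  have hBA : B ≤ A := by
    have h : B ≤ ∑ _j : Fin k, |C| * z * (A + B) := Finset.sum_le_sum fun j _ => hle j
    rw [Finset.sum_const, Finset.card_univ, Fintype.card_fin, nsmul_eq_mul, ← mul_assoc] at h
    nlinarith
  have hsum : (∑ a : Fin (n + 1) × Fin (n + 1),
      ‖p (Sum.inl a.1) * partialDeriv S.F (Sum.inl a.2) p‖) = z * A := by
    rw [hz, hA, Finset.sum_mul_sum, Fintype.sum_prod_type]
    simp
  rw [hsum, Real.norm_of_nonneg (by positivity)]
  refine (hle j).trans ?_
  have : |C| * z * (A + B) ≤ |C| * z * (A + A) := by gcongr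
  linarith

/-! ### Stalks of $m_Y$ and $J_z(F)$ -/

theorem toGerm_partialDeriv_mem_Jz {p : Ambient n k} (hp : p ∈ S.U) (i : Fin (n + 1)) :
    toGerm S.X _ (S.analyticAt_partialDeriv (Sum.inl i) hp) ∈ S.Jz p :=
  Ideal.subset_span ⟨i, rfl⟩

theorem toGerm_coord_mem_mY (p : Ambient n k) (i : Fin (n + 1)) :
    toGerm S.X _ (analyticAt_coord (Sum.inl i) p) ∈ S.mY p :=
  Ideal.subset_span ⟨i, rfl⟩

theorem mYJz_le_Jz (p : Ambient n k) : S.mYJz p ≤ S.Jz p := Ideal.mul_le_right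

theorem mYJz_eq_top {p : Ambient n k} (hX : p ∈ S.X) (hY : p ∉ S.Y) : S.mYJz p = ⊤ := by
  obtain ⟨i, hi⟩ := S.exists_partialDeriv_ne_zero hX hY
  obtain ⟨l, hl⟩ : ∃ l : Fin (n + 1), p (Sum.inl l) ≠ 0 := by
    by_contra! h
    exact hY ⟨hX.1, h⟩
  exact Ideal.eq_top_of_isUnit_mem _
    (Ideal.mul_mem_mul (S.toGerm_coord_mem_mY p l) (S.toGerm_partialDeriv_mem_Jz hX.1 i))
    ((isUnit_toGerm (analyticAt_coord _ p) hl).mul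
      (isUnit_toGerm (S.analyticAt_partialDeriv _ hX.1) hi))

/-- Under condition W, `J(F)_Y` lies in the integral closure of `m_Y J_z(F)`. -/
theorem JY_le_comap_map_mYJz {x : Ambient n k} (hx : x ∈ S.Y) (hW : S.ConditionW x)
    (φ : CurveGerm S.X x) :
    S.JY x ≤ ((S.mYJz x).map φ.pullback).comap φ.pullback := by
  refine Ideal.span_le.2 ?_
  rintro g ⟨j, hj⟩
  have ha : ∀ c, AnalyticAt ℂ (partialDeriv S.F c) (φ.toFun 0) := fun c =>
    S.analyticAt_partialDeriv c (φ.map_zero.symm ▸ hx.1)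
  have hz : ∀ c, AnalyticAt ℂ (fun p : Ambient n k => p c) (φ.toFun 0) := fun c =>
    analyticAt_coord c _
  have hg : φ.pullback g = toGerm Set.univ (partialDeriv S.F (Sum.inr j) ∘ φ.toFun)
      ((ha _).comp φ.analyticAt) := by
    obtain rfl : g = toGerm S.X _ (S.analyticAt_partialDeriv (Sum.inr j) hx.1) := Subtype.ext hj
    rfl
  change φ.pullback g ∈ (S.mYJz x).map φ.pullback
  rw [hg]
  have hO := (S.partialDeriv_isBigO hx hW j).comp_tendsto φ.tendsto
  rw [nhdsWithin_univ] at hO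
  refine toGerm_mem_of_isBigO (a := fun (a : Fin (n + 1) × Fin (n + 1)) t =>
    φ.toFun t (Sum.inl a.1) * partialDeriv S.F (Sum.inl a.2) (φ.toFun t))
    (fun a => ((hz _).comp φ.analyticAt).mul ((ha _).comp φ.analyticAt)) _ hO fun a => ?_
  exact Ideal.mem_map_of_mem φ.pullback (Ideal.mul_mem_mul (S.toGerm_coord_mem_mY x a.1)
    (S.toGerm_partialDeriv_mem_Jz hx.1 a.2))

/-! ### Doubles on and off the diagonal -/

theorem double_mono {I J : S.StalkIdeals} {q : Ambient n k × Ambient n k} (h₁ : I q.1 ≤ J q.1)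
    (h₂ : I q.2 ≤ J q.2) : S.double I q ≤ S.double J q :=
  Submodule.span_mono fun _ ⟨h, ha₁, ha₂, hm₁, hm₂, e⟩ => ⟨h, ha₁, ha₂, h₁ hm₁, h₂ hm₂, e⟩

/-- The first component of a curve in `X ×_Y X`. -/
def curveFst {q : Ambient n k × Ambient n k} (φ : CurveGerm S.fibreProduct q) :
    CurveGerm S.X q.1 where
  toFun t := (φ.toFun t).1
  analyticAt := analyticAt_fst.comp φ.analyticAt
  map_zero := congrArg Prod.fst φ.map_zero
  eventually_mem := φ.eventually_mem.mono fun _ h => h.1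

/-- The second component of a curve in `X ×_Y X`. -/
def curveSnd {q : Ambient n k × Ambient n k} (φ : CurveGerm S.fibreProduct q) :
    CurveGerm S.X q.2 where
  toFun t := (φ.toFun t).2
  analyticAt := analyticAt_snd.comp φ.analyticAt
  map_zero := congrArg Prod.snd φ.map_zero
  eventually_mem := φ.eventually_mem.mono fun _ h => h.2.1

/-- Functions analytic at two distinct points can be prescribed independently near them. -/
theorem exists_eventuallyEq_pair {x y : Ambient n k} (hxy : x ≠ y) (f g : Ambient n k → ℂ) :
    ∃ h : Ambient n k → ℂ, h =ᶠ[𝓝 x] f ∧ h =ᶠ[𝓝 y] g := by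
  classical
  obtain ⟨u, v, hu, hv, hxu, hyv, huv⟩ := t2_separation hxy
  refine ⟨u.piecewise f g, ?_, ?_⟩
  · filter_upwards [hu.mem_nhds hxu] with p hp
    simp [hp]
  · filter_upwards [hv.mem_nhds hyv] with p hp
    simp [Set.disjoint_right.1 huv hp]

/-- A single $h$ represents $a$ near one point and $b$ near the other. Taking $a=0$ or $b=0$
isolates a component. -/
theorem exists_mem_double {J : S.StalkIdeals} {q : Ambient n k × Ambient n k} (hq : q.1 ≠ q.2)
    {a : localRing S.X q.1} {b : localRing S.X q.2} (ha : a ∈ J q.1) (hb : b ∈ J q.2) :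
    ∃ m ∈ S.double J q, ∀ φ : CurveGerm S.fibreProduct q,
      φ.pullbackVec m = ![(S.curveFst φ).pullback a, (S.curveSnd φ).pullback b] := by
  obtain ⟨_, f, hf, rfl⟩ := a
  obtain ⟨_, g, hg, rfl⟩ := b
  obtain ⟨h, hhf, hhg⟩ := exists_eventuallyEq_pair hq f g
  have h₁ : AnalyticAt ℂ h q.1 := hf.congr hhf.symm
  have h₂ : AnalyticAt ℂ h q.2 := hg.congr hhg.symm
  have e₁ : toGerm S.X f hf = toGerm S.X h h₁ := toGerm_congr hf h₁ hhf.symm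
  have e₂ : toGerm S.X g hg = toGerm S.X h h₂ := toGerm_congr hg h₂ hhg.symm
  change toGerm S.X f hf ∈ _ at ha
  change toGerm S.X g hg ∈ _ at hb
  refine ⟨![toGerm _ (fun r => h r.1) (h₁.comp analyticAt_fst),
      toGerm _ (fun r => h r.2) (h₂.comp analyticAt_snd)],
    Submodule.subset_span ⟨h, h₁, h₂, e₁ ▸ ha, e₂ ▸ hb, rfl, rfl⟩, fun φ => ?_⟩
  change _ = ![(S.curveFst φ).pullback (toGerm S.X f hf), (S.curveSnd φ).pullback (toGerm S.X g hg)]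
  rw [e₁, e₂]
  funext i
  fin_cases i <;> rfl

/-- At a point off the diagonal, inclusions of ideals in integral closures pass to the doubles. -/
theorem double_le_integralClosure {I J : S.StalkIdeals} {q : Ambient n k × Ambient n k}
    (hq : q.1 ≠ q.2)
    (h₁ : ∀ φ : CurveGerm S.X q.1, I q.1 ≤ ((J q.1).map φ.pullback).comap φ.pullback)
    (h₂ : ∀ φ : CurveGerm S.X q.2, I q.2 ≤ ((J q.2).map φ.pullback).comap φ.pullback) :
    S.double I q ≤ integralClosure (S.double J q) := by
  refine Submodule.span_le.2 ?_
  rintro m ⟨h, ha₁, ha₂, hm₁, hm₂, e₀, e₁⟩ φ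
  have hfst : ∀ a ∈ (J q.1).map (S.curveFst φ).pullback,
      ![a, 0] ∈ φ.pullbackModule (S.double J q) := by
    intro a ha
    refine Submodule.span_induction ?_ ?_ ?_ ?_ ha
    · rintro _ ⟨b, hb, rfl⟩
      obtain ⟨m, hm, e⟩ := S.exists_mem_double hq hb (J q.2).zero_mem
      refine Submodule.subset_span ⟨m, hm, ?_⟩
      rw [e, map_zero]
    · convert (φ.pullbackModule (S.double J q)).zero_mem
      simp
    · intro a b _ _ ha hb
      simpa using Submodule.add_mem _ ha hb
    · intro c a _ ha
      simpa using Submodule.smul_mem _ c ha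
  have hsnd : ∀ a ∈ (J q.2).map (S.curveSnd φ).pullback,
      ![0, a] ∈ φ.pullbackModule (S.double J q) := by
    intro a ha
    refine Submodule.span_induction ?_ ?_ ?_ ?_ ha
    · rintro _ ⟨b, hb, rfl⟩
      obtain ⟨m, hm, e⟩ := S.exists_mem_double hq (J q.1).zero_mem hb
      refine Submodule.subset_span ⟨m, hm, ?_⟩
      rw [e, map_zero]
    · convert (φ.pullbackModule (S.double J q)).zero_mem
      simp
    · intro a b _ _ ha hb
      simpa using Submodule.add_mem _ ha hb
    · intro c a _ ha
      simpa using Submodule.smul_mem _ c ha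
  have hm : φ.pullbackVec m = ![(S.curveFst φ).pullback (toGerm S.X h ha₁), 0] +
      ![0, (S.curveSnd φ).pullback (toGerm S.X h ha₂)] := by
    have e₀' : m 0 = toGerm _ (fun r => h r.1)
      (ha₁.comp analyticAt_fst) := Subtype.ext e₀
    have e₁' : m 1 = toGerm _ (fun r => h r.2)
      (ha₂.comp analyticAt_snd) := Subtype.ext e₁
    funext i
    fin_cases i
    · simp [CurveGerm.pullbackVec, e₀']
      rfl
    · simp [CurveGerm.pullbackVec, e₁']
      rfl
  rw [hm]
  exact Submodule.add_mem _ (hfst _ (h₁ _ hm₁)) (hsnd _ (h₂ _ hm₂))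

theorem iLA_of_iLmY {q : Ambient n k × Ambient n k} (h : S.iLmY q) : S.iLA q :=
  h.trans (integralClosure_mono (S.double_mono (S.mYJz_le_Jz _) (S.mYJz_le_Jz _)))

theorem iLmY_of_mem_diagonal {q : Ambient n k × Ambient n k}
    (hq : q ∈ S.diagonal \ S.yTimesZero) : S.iLmY q := by
  obtain ⟨⟨hq, he⟩, hq'⟩ := hq
  have h₁ : q.1 ∉ S.Y := fun h => hq' ⟨hq, h, he ▸ h⟩
  have h₂ : q.2 ∉ S.Y := he ▸ h₁
  refine (S.double_mono ?_ ?_).trans (le_integralClosure _)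
  · rw [S.mYJz_eq_top hq.1 h₁]
    exact le_top
  · rw [S.mYJz_eq_top hq.2.1 h₂]
    exact le_top

theorem iLmY_of_ne {q : Ambient n k × Ambient n k} (hq : q ∈ S.fibreProduct) (hne : q.1 ≠ q.2)
    (h₁ : q.1 ∈ S.Y → S.ConditionW q.1) (h₂ : q.2 ∈ S.Y → S.ConditionW q.2) : S.iLmY q := by
  have key : ∀ x ∈ S.X, (x ∈ S.Y → S.ConditionW x) → ∀ φ : CurveGerm S.X x,
      S.JY x ≤ ((S.mYJz x).map φ.pullback).comap φ.pullback := by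
    intro x hx hW φ
    by_cases hY : x ∈ S.Y
    · exact S.JY_le_comap_map_mYJz hY (hW hY) φ
    · rw [S.mYJz_eq_top hx hY, Ideal.map_top, Ideal.comap_top]
      exact le_top
  exact S.double_le_integralClosure hne (key _ hq.1 h₁) (key _ hq.2.1 h₂)

theorem eq_of_mem_Y {p p' : Ambient n k} (hp : p ∈ S.Y) (hp' : p' ∈ S.Y)
    (h : ∀ j : Fin k, p (Sum.inr j) = p' (Sum.inr j)) : p = p' := by
  ext c
  rcases c with i | j
  · rw [hp.2 i, hp'.2 i]
  · exact h j

end HypersurfaceFamily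

end LipschitzFamily

end

theorem proposition4p2 {n k : ℕ} (S : LipschitzFamily.HypersurfaceFamily n k) :
    (∀ q ∈ S.diagonal \ S.yTimesZero, S.iLA q ∧ S.iLmY q) ∧
    (∀ q ∈ (S.zeroFibreX ∪ S.xFibreZero) \ S.yTimesZero,
      ∀ y₀ ∈ S.Y, (∀ j : Fin k, y₀ (Sum.inr j) = q.1 (Sum.inr j)) → S.ConditionW y₀ →
        S.iLA q ∧ S.iLmY q) := by
  refine ⟨fun q hq => ?_, fun q hq y₀ hy₀ hy hW => ?_⟩
  · have h := S.iLmY_of_mem_diagonal hq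
    exact ⟨S.iLA_of_iLmY h, h⟩
  obtain ⟨hq, hq'⟩ := hq
  have hf : q ∈ S.fibreProduct := hq.elim (·.1) (·.1)
  -- A diagonal point with one component in $Y$ has both there.
  have hne : q.1 ≠ q.2 := fun he =>
    hq' (hq.elim (fun h => ⟨hf, h.2, he ▸ h.2⟩) fun h => ⟨hf, he ▸ h.2, h.2⟩)
  have h := S.iLmY_of_ne hf hne
    -- A component lying in $Y$ is `y₀` itself, having the same parameter.
    (fun h₁ => S.eq_of_mem_Y hy₀ h₁ hy ▸ hW)
    (fun h₂ => S.eq_of_mem_Y hy₀ h₂ (fun j => (hy j).trans (hf.2.2 j)) ▸ hW)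
  exact ⟨S.iLA_of_iLmY h, h⟩
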